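/- Let $\Sigma=\{0,1\}^{\mathbb N}$. For a word $\epsilon_1\dots\epsilon_n\in\{0,1\}^n$ let $I_{\epsilon_1\dots\epsilon_n}\subset\Sigma$ be the cylinder of all sequences that begin with $\epsilon_1,\dots,\epsilon_n$, and let $\mathcal F_n$ be the set of these cylinders of generation $n$. A Borel probability measure $\mu$ on $\Sigma$ is called an inhomogeneous Bernoulli product if there are weights $p_j\in(0,1)$, $j\ge 1$, such that $$\mu(I_{\epsilon_1\dots\epsilon_n})=\prod_{j=1}^n p_j^{1-\epsilon_j}(1-p_j)^{\epsilon_j}$$ for all $n$ and all $\epsilon_1,\dots,\epsilon_n\in\{0,1\}$. Its $L^q$-spectrum is $$\tau_\mu(q)=\limsup_{n\to\infty}\frac{1}{n\log 2}\log\Big(\sum_{I\in\mathcal F_n,\ \mu(I)\neq 0}\mu(I)^q\Big),$$ and a point $q$ is called a phase transition of $\mu$ if $\tau_\mu$ is not differentiable at $q$. Theorem. There exists an inhomogeneous Bernoulli product $\mu$ whose set of phase transitions in $[1,\infty)$ is dense in $[1,\infty)$. -/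

import Mathlib

open MeasureTheory Filter Set
open scoped Topology

namespace InhomBernoulli

noncomputable section

/-- The cylinder `I_{ε₁…εₙ}` of generation `n` in the Cantor set `Σ = {0,1}^ℕ`
(coordinates are numbered from `0`). -/
def cyl {n : ℕ} (ε : Fin n → Fin 2) : Set (ℕ → Fin 2) :=
  {x | ∀ j : Fin n, x j = ε j}

/-- `μ` is an inhomogeneous Bernoulli product: for some weights `p_j ∈ (0,1)`,
`μ(I_{ε₁…εₙ}) = ∏_{j ≤ n} p_j^{1-ε_j} (1-p_j)^{ε_j}` for all cylinders.
The case `n = 0` says that `μ` is a probability measure. -/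
def IsInhomogeneousBernoulliProduct (μ : Measure (ℕ → Fin 2)) : Prop :=
  ∃ p : ℕ → ℝ, (∀ j, p j ∈ Ioo (0 : ℝ) 1) ∧
    ∀ (n : ℕ) (ε : Fin n → Fin 2),
      μ (cyl ε) = ENNReal.ofReal
        (∏ j : Fin n, p j ^ (1 - (ε j : ℕ)) * (1 - p j) ^ (ε j : ℕ))

open scoped Classical in
/-- `τ_{μ,n}(q) = (1 / (n log 2)) log ∑ μ(I)^q`, the sum running over the cylinders `I`
of generation `n` with `μ(I) ≠ 0`. -/
def spectrumAt (μ : Measure (ℕ → Fin 2)) (n : ℕ) (q : ℝ) : ℝ :=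
  1 / (n * Real.log 2) *
    Real.log (∑ ε : Fin n → Fin 2 with μ (cyl ε) ≠ 0, (μ (cyl ε)).toReal ^ q)

/-- The `L^q`-spectrum `τ_μ(q) = limsup_n τ_{μ,n}(q)`. For a probability measure and `q ≥ 0`
the sequence `τ_{μ,n}(q)` is bounded (it lies between `-q` and `1`), so that the real `limsup`
is the true one. -/
def lqSpectrum (μ : Measure (ℕ → Fin 2)) (q : ℝ) : ℝ :=
  limsup (fun n : ℕ => spectrumAt μ n q) atTop

/-- `q` is a phase transition of `μ` if `τ_μ'(q)` does not exist. -/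
def IsPhaseTransition (μ : Measure (ℕ → Fin 2)) (q : ℝ) : Prop :=
  ¬ DifferentiableAt ℝ (lqSpectrum μ) q

end

end InhomBernoulli

/-!
For `q ≥ 0` the sum `∑ μ(I)^q` over a generation factorises, so that `τ_{μ,n}(q) log 2` is the
average over `j < n` of `log (p_j^q + (1-p_j)^q)`. Write `φ(p, q)` for this function. It is convex
in `q`, vanishes at `q = 1`, equals `(1 - q) log 2` for `p = 1/2`, and tends to `0` as `p → 1`
when `q > 1`.

Take a dense sequence `q_k` in `(1, ∞)` and, by the intermediate value theorem, `P_k ∈ (1/2, 1)`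
with `φ(P_k, q_k) = (1 - q_k) log 2 / 2`. The right-hand side is, in the limit, the mean
contribution of a coordinate of weight `1/2` and one of weight close to `1`. As `φ(P_k, ·)` is
strictly convex and agrees with this line at `1` and at `q_k`, it crosses the line transversally at
`q_k`, so the maximum of the two functions has a kink there (`exists_secondDiff_kinkFun_ge`).

The coordinates are grouped in pairs, and the pairs are sorted into classes, the `k`-th of density
`2⁻¹ ^ (k + 1)`. The pairs of the `k`-th class have either both weights `P_k`, or weights `1/2` and
nearly `1`. This choice is made for all classes at once in each of a sequence of rapidly growing
blocks, and every finite pattern of choices occurs in infinitely many blocks. No choice makes the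
contribution of a pair larger than the maximum above, and at the end of a block whose pattern is
optimal for the first `K` classes at the given `q` the average is nearly the optimal one. The
limit superior thus maximises each class separately (`lqSpectrum_eq`): on `(1, ∞)`,
`τ_μ(q) log 2` is the sum over `k` of `2⁻¹ ^ (k + 1)` times the maximum belonging to class `k`.
All terms are convex, so the kink of one term cannot be cancelled by the others: symmetric second
differences at `q_k` are bounded below by a positive multiple of the step
(`secondDiff_meanKink_ge`), and `τ_μ` is not differentiable at any `q_k`.
-/

namespace InhomBernoulli

/-! ### The moment function of a single coordinate -/

/-- `log (p^q + (1-p)^q)`, the contribution of a coordinate of weight `p` to the logarithm of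
the `q`-th moment sum. -/
noncomputable def logMoment (p q : ℝ) : ℝ :=
  Real.log (p ^ q + (1 - p) ^ q)

lemma moment_pos {p : ℝ} (hp : p ∈ Ioo (0 : ℝ) 1) (q : ℝ) : 0 < p ^ q + (1 - p) ^ q :=
  add_pos (Real.rpow_pos_of_pos hp.1 q) (Real.rpow_pos_of_pos (sub_pos.2 hp.2) q)

lemma logMoment_nonpos {p q : ℝ} (hp : p ∈ Ioo (0 : ℝ) 1) (hq : 1 ≤ q) : logMoment p q ≤ 0 := by
  refine Real.log_nonpos (moment_pos hp q).le ?_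
  have h1 := Real.rpow_le_rpow_of_exponent_ge hp.1 hp.2.le hq
  have h2 := Real.rpow_le_rpow_of_exponent_ge (x := 1 - p) (by linarith [hp.2])
    (by linarith [hp.1]) hq
  rw [Real.rpow_one] at h1 h2
  linarith

lemma logMoment_half (q : ℝ) : logMoment (1 / 2) q = (1 - q) * Real.log 2 := by
  have h : (1 / 2 : ℝ) ^ q + (1 - 1 / 2) ^ q = (2 : ℝ) ^ (1 - q) := by
    rw [show (1 - 1 / 2 : ℝ) = 1 / 2 by norm_num, Real.rpow_sub two_pos, Real.rpow_one,
      Real.div_rpow one_pos.le two_pos.le, Real.one_rpow]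
    ring
  rw [logMoment, h, Real.log_rpow two_pos]

lemma neg_mul_log_two_le_logMoment {p q : ℝ} (hp : p ∈ Ioo (0 : ℝ) 1) (hq : 0 ≤ q) :
    -(q * Real.log 2) ≤ logMoment p q := by
  have key : ((1 / 2 : ℝ)) ^ q ≤ p ^ q + (1 - p) ^ q := by
    have h1 := Real.rpow_nonneg hp.1.le q
    have h2 := Real.rpow_nonneg (sub_pos.2 hp.2).le q
    rcases le_total (1 / 2) p with h | h
    · linarith [Real.rpow_le_rpow (by norm_num) h hq]
    · linarith [Real.rpow_le_rpow (z := q) (by norm_num) (show (1 / 2 : ℝ) ≤ 1 - p by linarith) hq]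
  have := Real.log_le_log (by positivity) key
  rwa [Real.log_rpow (by norm_num), one_div, Real.log_inv, mul_neg] at this

lemma convexOn_logMoment {p : ℝ} (hp : p ∈ Ioo (0 : ℝ) 1) : ConvexOn ℝ univ (logMoment p) := by
  refine ⟨convex_univ, fun x _ y _ a b ha hb hab => ?_⟩
  have hr : 0 < 1 - p := sub_pos.2 hp.2
  have hX := moment_pos hp x
  have hY := moment_pos hp y
  set X := p ^ x + (1 - p) ^ x with hXdef
  set Y := p ^ y + (1 - p) ^ y with hYdef
  -- Hölder's inequality for two terms, from the weighted mean inequality for each term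
  have amgm (t : ℝ) (ht : 0 < t) :
      t ^ (a * x + b * y) ≤ (a * (t ^ x / X) + b * (t ^ y / Y)) * (X ^ a * Y ^ b) := by
    have h := Real.geom_mean_le_arith_mean2_weighted ha hb
      (div_nonneg (Real.rpow_nonneg ht.le x) hX.le) (div_nonneg (Real.rpow_nonneg ht.le y) hY.le)
      hab
    have hpos : 0 < X ^ a * Y ^ b := by positivity
    refine le_trans (le_of_eq ?_) (mul_le_mul_of_nonneg_right h hpos.le)
    rw [Real.div_rpow (by positivity) hX.le, Real.div_rpow (by positivity) hY.le,
      ← Real.rpow_mul ht.le, ← Real.rpow_mul ht.le, Real.rpow_add ht]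
    have h1 : X ^ a ≠ 0 := by positivity
    have h2 : Y ^ b ≠ 0 := by positivity
    rw [mul_comm x a, mul_comm y b]
    field_simp
  have hle : p ^ (a * x + b * y) + (1 - p) ^ (a * x + b * y) ≤ X ^ a * Y ^ b := by
    refine (add_le_add (amgm p hp.1) (amgm (1 - p) hr)).trans (le_of_eq ?_)
    have h1 : p ^ x / X + (1 - p) ^ x / X = 1 := by rw [← add_div, div_self hX.ne']
    have h2 : p ^ y / Y + (1 - p) ^ y / Y = 1 := by rw [← add_div, div_self hY.ne']
    linear_combination (a * h1 + b * h2 + hab) * (X ^ a * Y ^ b)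
  have := Real.log_le_log (moment_pos hp _) hle
  rwa [Real.log_mul (by positivity) (by positivity), Real.log_rpow hX, Real.log_rpow hY] at this

/-- Strict convexity of `logMoment p` between `1`, where it vanishes, and `q`. -/
lemma logMoment_midpoint_lt {p q : ℝ} (hp : p ∈ Ioo (1 / 2 : ℝ) 1) (hq : 1 < q) :
    logMoment p ((1 + q) / 2) < logMoment p q / 2 := by
  have hp0 : 0 < p := by linarith [hp.1]
  have hp' : p ∈ Ioo (0 : ℝ) 1 := ⟨hp0, hp.2⟩
  have hr : 0 < 1 - p := sub_pos.2 hp.2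
  have hsq (t : ℝ) (ht : 0 < t) : t ^ ((1 + q) / 2) = t * t ^ ((q - 1) / 2) := by
    rw [show (1 + q) / 2 = 1 + (q - 1) / 2 by ring, Real.rpow_add ht, Real.rpow_one]
  have hq' (t : ℝ) (ht : 0 < t) : t ^ q = t * (t ^ ((q - 1) / 2)) ^ 2 := by
    rw [show q = 1 + (q - 1) / 2 + (q - 1) / 2 by ring, Real.rpow_add ht, Real.rpow_add ht,
      Real.rpow_one]
    ring_nf
  have hlt : (1 - p) ^ ((q - 1) / 2) < p ^ ((q - 1) / 2) :=
    Real.rpow_lt_rpow hr.le (by linarith [hp.1]) (by linarith)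
  have h : (p ^ ((1 + q) / 2) + (1 - p) ^ ((1 + q) / 2)) ^ 2 < p ^ q + (1 - p) ^ q := by
    rw [hsq p hp0, hsq _ hr, hq' p hp0, hq' _ hr]
    have := mul_pos (mul_pos hp0 hr) (pow_pos (sub_pos.2 hlt) 2)
    linarith
  have h2 := Real.log_lt_log (pow_pos (moment_pos hp' _) 2) h
  rw [Real.log_pow] at h2
  simp only [logMoment]
  push_cast at h2
  linarith

lemma continuous_logMoment_left {q : ℝ} (hq : 0 < q) :
    ContinuousOn (fun p => logMoment p q) (Ioc 0 1) := by
  refine ContinuousOn.log ?_ ?_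
  · exact ((Real.continuous_rpow_const hq.le).add
      ((Real.continuous_rpow_const hq.le).comp (continuous_const.sub continuous_id))).continuousOn
  · intro p hp
    exact (add_pos_of_pos_of_nonneg (Real.rpow_pos_of_pos hp.1 q)
      (Real.rpow_nonneg (sub_nonneg.2 hp.2) q)).ne'

lemma logMoment_one {q : ℝ} (hq : 0 < q) : logMoment 1 q = 0 := by
  simp [logMoment, Real.zero_rpow hq.ne']

/-- The intermediate value theorem in the weight places a crossing of `logMoment p` with the line
`(1 - q) log 2 / 2` at any prescribed `q > 1`. -/
lemma exists_logMoment_eq {q : ℝ} (hq : 1 < q) :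
    ∃ p ∈ Ioo (1 / 2 : ℝ) 1, logMoment p q = (1 - q) * Real.log 2 / 2 := by
  have hc : ContinuousOn (fun p => logMoment p q) (Icc (1 / 2) 1) :=
    (continuous_logMoment_left (by linarith)).mono
      fun p hp => ⟨by linarith [hp.1], hp.2⟩
  have hneg : (1 - q) * Real.log 2 < 0 :=
    mul_neg_of_neg_of_pos (by linarith) (Real.log_pos one_lt_two)
  have := intermediate_value_Ioo (by norm_num) hc
  simp only [logMoment_half, logMoment_one (show 0 < q by linarith)] at this
  obtain ⟨p, hp, h⟩ := this ⟨show _ < (1 - q) * Real.log 2 / 2 by linarith, by linarith⟩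
  exact ⟨p, hp, h⟩

/-! ### The kink of the larger of two competing exponents -/

/-- The larger of `logMoment p` and the line `(1 - q) log 2 / 2`, the latter being the mean
contribution of a coordinate of weight `1/2` and one of weight close to `1`. -/
noncomputable def kinkFun (p q : ℝ) : ℝ :=
  max (logMoment p q) ((1 - q) * Real.log 2 / 2)

lemma convexOn_kinkFun {p : ℝ} (hp : p ∈ Ioo (0 : ℝ) 1) : ConvexOn ℝ univ (kinkFun p) := by
  refine (convexOn_logMoment hp).sup ⟨convex_univ, fun x _ y _ a b _ _ hab => le_of_eq ?_⟩
  simp only [smul_eq_mul]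
  linear_combination (-(Real.log 2 / 2)) * hab

lemma kinkFun_nonpos {p q : ℝ} (hp : p ∈ Ioo (0 : ℝ) 1) (hq : 1 ≤ q) : kinkFun p q ≤ 0 :=
  max_le (logMoment_nonpos hp hq)
    (by nlinarith [Real.log_pos one_lt_two])

lemma neg_mul_log_two_le_kinkFun {p q : ℝ} (hp : p ∈ Ioo (0 : ℝ) 1) (hq : 0 ≤ q) :
    -(q * Real.log 2) ≤ kinkFun p q :=
  (neg_mul_log_two_le_logMoment hp hq).trans (le_max_left _ _)

lemma secondDiff_kinkFun_nonneg {p : ℝ} (hp : p ∈ Ioo (0 : ℝ) 1) (q h : ℝ) :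
    0 ≤ kinkFun p (q + h) + kinkFun p (q - h) - 2 * kinkFun p q := by
  have := (convexOn_kinkFun hp).2 (mem_univ (q + h)) (mem_univ (q - h))
    (show (0 : ℝ) ≤ 1 / 2 by norm_num) (show (0 : ℝ) ≤ 1 / 2 by norm_num) (by norm_num)
  simp only [smul_eq_mul] at this
  rw [show 1 / 2 * (q + h) + 1 / 2 * (q - h) = q by ring] at this
  linarith

/-- At a crossing point the second difference of `kinkFun p` is at least linear. The difference
of the two competitors is convex, vanishes at `1` and at `q`, and is negative half way, so it
leaves `q` with positive slope. -/
lemma exists_secondDiff_kinkFun_ge {p q : ℝ} (hp : p ∈ Ioo (1 / 2 : ℝ) 1) (hq : 1 < q)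
    (hpq : logMoment p q = (1 - q) * Real.log 2 / 2) :
    ∃ c > 0, ∀ h > 0, c * h ≤ kinkFun p (q + h) + kinkFun p (q - h) - 2 * kinkFun p q := by
  have hmid := logMoment_midpoint_lt hp hq
  set m := (1 + q) / 2 with hm
  have hmq : 0 < q - m := by linarith
  refine ⟨(logMoment p q / 2 - logMoment p m) / (q - m), div_pos (by linarith) hmq,
    fun h hh => ?_⟩
  have hs := (convexOn_logMoment (p := p) ⟨by linarith [hp.1], hp.2⟩).slope_mono_adjacent
    (mem_univ m) (mem_univ (q + h)) (show m < q by linarith) (show q < q + h by linarith)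
  rw [show q + h - q = h by ring, le_div_iff₀ hh] at hs
  have hsplit : (logMoment p q - logMoment p m) / (q - m)
      = (logMoment p q / 2 - logMoment p m) / (q - m) - Real.log 2 / 2 := by
    rw [div_eq_iff hmq.ne', sub_mul, div_mul_cancel₀ _ hmq.ne']
    linear_combination (1 / 2) * hpq + (Real.log 2 / 2) * (-hm)
  rw [hsplit] at hs
  have h1 : logMoment p (q + h) ≤ kinkFun p (q + h) := le_max_left _ _
  have h2 : (1 - (q - h)) * Real.log 2 / 2 ≤ kinkFun p (q - h) := le_max_right _ _
  have h3 : kinkFun p q = (1 - q) * Real.log 2 / 2 := by rw [kinkFun, hpq, max_self]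
  rw [h3]
  linarith

/-! ### Bernoulli products and their spectra -/

lemma cyl_eq_pi {n : ℕ} (ε : Fin n → Fin 2) :
    cyl ε = Set.pi (Finset.range n) (fun j => if h : j < n then {ε ⟨j, h⟩} else univ) := by
  ext x
  simp only [cyl, mem_ofPred_eq, Set.mem_pi, Finset.coe_range, mem_Iio]
  constructor
  · intro h j hj
    simpa [hj] using h ⟨j, hj⟩
  · intro h j
    simpa using h j j.2

lemma exists_measure_cyl_eq (p : ℕ → ℝ) (hp : ∀ j, p j ∈ Ioo (0 : ℝ) 1) :
    ∃ μ : Measure (ℕ → Fin 2), ∀ (n : ℕ) (ε : Fin n → Fin 2),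
      μ (cyl ε) = ENNReal.ofReal
        (∏ j : Fin n, p j ^ (1 - (ε j : ℕ)) * (1 - p j) ^ (ε j : ℕ)) := by
  have hnn (j : ℕ) (i : Fin 2) : 0 ≤ p j ^ (1 - (i : ℕ)) * (1 - p j) ^ (i : ℕ) :=
    mul_nonneg (pow_nonneg (hp j).1.le _) (pow_nonneg (sub_pos.2 (hp j).2).le _)
  have hsum (j : ℕ) :
      ∑ i : Fin 2, ENNReal.ofReal (p j ^ (1 - (i : ℕ)) * (1 - p j) ^ (i : ℕ)) = 1 := by
    rw [← ENNReal.ofReal_sum_of_nonneg fun i _ => hnn j i]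
    simp [Fin.sum_univ_two]
  let ν (j : ℕ) : Measure (Fin 2) := (PMF.ofFintype _ (hsum j)).toMeasure
  refine ⟨Measure.infinitePi ν, fun n ε => ?_⟩
  rw [cyl_eq_pi, Measure.infinitePi_pi _ fun i _ => MeasurableSet.of_discrete,
    ENNReal.ofReal_prod_of_nonneg fun (j : Fin n) _ => hnn j (ε j), Finset.prod_range]
  refine Finset.prod_congr rfl fun j _ => ?_
  simp only [Fin.is_lt, dif_pos, ν]
  rw [PMF.toMeasure_apply_singleton _ _ (MeasurableSet.of_discrete), PMF.ofFintype_apply]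

lemma spectrumAt_eq_sum {μ : Measure (ℕ → Fin 2)} {p : ℕ → ℝ} (hp : ∀ j, p j ∈ Ioo (0 : ℝ) 1)
    (hμ : ∀ (n : ℕ) (ε : Fin n → Fin 2), μ (cyl ε) = ENNReal.ofReal
        (∏ j : Fin n, p j ^ (1 - (ε j : ℕ)) * (1 - p j) ^ (ε j : ℕ))) (n : ℕ) (q : ℝ) :
    spectrumAt μ n q = 1 / (n * Real.log 2) * ∑ j ∈ Finset.range n, logMoment (p j) q := by
  have hpos (j : ℕ) (i : Fin 2) : 0 < p j ^ (1 - (i : ℕ)) * (1 - p j) ^ (i : ℕ) :=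
    mul_pos (pow_pos (hp j).1 _) (pow_pos (sub_pos.2 (hp j).2) _)
  have hprod (ε : Fin n → Fin 2) :
      0 < ∏ j : Fin n, p j ^ (1 - (ε j : ℕ)) * (1 - p j) ^ (ε j : ℕ) :=
    Finset.prod_pos fun j _ => hpos j (ε j)
  rw [spectrumAt, Finset.filter_true_of_mem fun ε _ => by
    rw [hμ]; exact (ENNReal.ofReal_pos.2 (hprod ε)).ne']
  congr 1
  have hterm (ε : Fin n → Fin 2) : (μ (cyl ε)).toReal ^ q
      = ∏ j : Fin n, (p j ^ (1 - (ε j : ℕ)) * (1 - p j) ^ (ε j : ℕ)) ^ q := by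
    rw [hμ, ENNReal.toReal_ofReal (hprod ε).le,
      Real.finsetProd_rpow _ _ fun (j : Fin n) _ => (hpos j (ε j)).le]
  rw [Finset.sum_congr rfl fun ε _ => hterm ε, Finset.sum_range]
  have hswap := Finset.prod_univ_sum (fun _ : Fin n => (Finset.univ : Finset (Fin 2)))
    (fun j i => (p j ^ (1 - (i : ℕ)) * (1 - p j) ^ (i : ℕ)) ^ q)
  rw [Fintype.piFinset_univ] at hswap
  rw [← hswap, Real.log_prod fun j _ => ?_]
  · refine Finset.sum_congr rfl fun j _ => ?_
    simp [Fin.sum_univ_two, logMoment]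
  · exact (Finset.sum_pos (fun i _ => Real.rpow_pos_of_pos (hpos j i) q)
      Finset.univ_nonempty).ne'

/-! ### Averages over dyadic classes -/

/-- The dyadic class of `j`: the exponent of `2` in `j + 1`. Class `k` has density
`2⁻¹ ^ (k + 1)`. -/
def dyadicClass (j : ℕ) : ℕ := padicValNat 2 (j + 1)

lemma le_dyadicClass_iff {k j : ℕ} : k ≤ dyadicClass j ↔ 2 ^ k ∣ j + 1 :=
  (padicValNat_dvd_iff_le (Nat.succ_ne_zero j)).symm

lemma card_le_dyadicClass (n k : ℕ) :
    ((Finset.range n).filter fun j => k ≤ dyadicClass j).card = n / 2 ^ k := by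
  simp only [le_dyadicClass_iff, Nat.card_multiples]

lemma card_dyadicClass_eq_add (n k : ℕ) :
    ((Finset.range n).filter fun j => dyadicClass j = k).card + n / 2 ^ (k + 1) = n / 2 ^ k := by
  rw [← card_le_dyadicClass n k, ← card_le_dyadicClass n (k + 1),
    ← Finset.card_union_of_disjoint]
  · congr 1
    ext j
    simp only [Finset.mem_union, Finset.mem_filter]
    constructor
    · rintro (⟨h, h'⟩ | ⟨h, h'⟩) <;> exact ⟨h, by omega⟩
    · rintro ⟨h, h'⟩
      rcases h'.eq_or_lt with h'' | h''
      · exact Or.inl ⟨h, h''.symm⟩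
      · exact Or.inr ⟨h, h''⟩
  · refine Finset.disjoint_filter.2 fun j _ h h' => ?_
    omega

lemma tendsto_nat_div_div (d : ℕ) :
    Tendsto (fun n : ℕ => ((n / d : ℕ) : ℝ) / n) atTop (𝓝 (d : ℝ)⁻¹) := by
  have h := (tendsto_nat_floor_mul_div_atTop (R := ℝ) (a := (d : ℝ)⁻¹) (by positivity)).comp
    tendsto_natCast_atTop_atTop
  refine h.congr fun n => ?_
  simp only [Function.comp_apply]
  rw [inv_mul_eq_div, Nat.floor_div_eq_div]

lemma tendsto_card_dyadicClass (k : ℕ) :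
    Tendsto (fun n : ℕ => (((Finset.range n).filter fun j => dyadicClass j = k).card : ℝ) / n)
      atTop (𝓝 ((2⁻¹ : ℝ) ^ (k + 1))) := by
  have h := (tendsto_nat_div_div (2 ^ k)).sub (tendsto_nat_div_div (2 ^ (k + 1)))
  have e : (((2 ^ k : ℕ) : ℝ)⁻¹ - ((2 ^ (k + 1) : ℕ) : ℝ)⁻¹) = (2⁻¹ : ℝ) ^ (k + 1) := by
    push_cast
    rw [← inv_pow, ← inv_pow]
    ring
  rw [e] at h
  refine h.congr fun n => ?_
  have := card_dyadicClass_eq_add n k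
  rw [← sub_div]
  congr 1
  rw [sub_eq_iff_eq_add]
  exact_mod_cast this.symm

lemma sum_dyadicClass_eq_tsum (g : ℕ → ℝ) (n : ℕ) :
    ∑ j ∈ Finset.range n, g (dyadicClass j)
      = ∑' k, (((Finset.range n).filter fun j => dyadicClass j = k).card : ℝ) * g k := by
  have hlt (j : ℕ) (hj : j ∈ Finset.range n) : dyadicClass j ∈ Finset.range n := by
    have h1 := Nat.le_of_dvd (Nat.succ_pos j) (le_dyadicClass_iff.1 (le_refl (dyadicClass j)))
    have h2 := (dyadicClass j).lt_two_pow_self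
    rw [Finset.mem_range] at *
    omega
  rw [tsum_eq_sum (s := Finset.range n), ← Finset.sum_fiberwise_of_maps_to hlt]
  · refine Finset.sum_congr rfl fun k _ => ?_
    rw [Finset.sum_congr rfl fun j hj => by rw [(Finset.mem_filter.1 hj).2], Finset.sum_const,
      nsmul_eq_mul]
  · intro k hk
    rw [Finset.filter_false_of_mem, Finset.card_empty, Nat.cast_zero, zero_mul]
    rintro j hj rfl
    exact hk (hlt j hj)

/-- The averages of a bounded function of the dyadic class converge. -/
lemma tendsto_average_dyadicClass {g : ℕ → ℝ} {C : ℝ} (hg : ∀ k, |g k| ≤ C) :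
    Tendsto (fun n : ℕ => (∑ j ∈ Finset.range n, g (dyadicClass j)) / n) atTop
      (𝓝 (∑' k, (2⁻¹ : ℝ) ^ (k + 1) * g k)) := by
  have hC : 0 ≤ C := (abs_nonneg _).trans (hg 0)
  have h : Tendsto (fun n : ℕ => ∑' k,
      (((Finset.range n).filter fun j => dyadicClass j = k).card : ℝ) / n * g k) atTop
      (𝓝 (∑' k, (2⁻¹ : ℝ) ^ (k + 1) * g k)) := by
    refine tendsto_tsum_of_dominated_convergence (bound := fun k => (2⁻¹ : ℝ) ^ k * C)
      ((summable_geometric_of_lt_one (by norm_num) (by norm_num)).mul_right C)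
      (fun k => (tendsto_card_dyadicClass k).mul_const _) (Eventually.of_forall fun n k => ?_)
    rw [norm_mul, Real.norm_eq_abs, Real.norm_eq_abs, abs_of_nonneg (by positivity)]
    refine mul_le_mul ?_ (hg k) (abs_nonneg _) (by positivity)
    refine div_le_of_le_mul₀ (by positivity) (by positivity) ?_
    have h1 : ((Finset.range n).filter fun j => dyadicClass j = k).card ≤ n / 2 ^ k :=
      (Nat.le_add_right _ _).trans_eq (card_dyadicClass_eq_add n k)
    calc (((Finset.range n).filter fun j => dyadicClass j = k).card : ℝ)
        ≤ ((n / 2 ^ k : ℕ) : ℝ) := by exact_mod_cast h1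
      _ ≤ (n : ℝ) / ((2 ^ k : ℕ) : ℝ) := Nat.cast_div_le
      _ = (2⁻¹ : ℝ) ^ k * n := by
        push_cast
        rw [inv_pow, div_eq_inv_mul]
  refine h.congr fun n => ?_
  rw [sum_dyadicClass_eq_tsum, ← tsum_div_const]
  exact tsum_congr fun k => by ring

/-- The mean of `kinkFun (P k)` with respect to the densities of the dyadic classes. Up to the
factor `log 2` this is the spectrum of the measure constructed below, on `(1, ∞)`. -/
noncomputable def meanKink (P : ℕ → ℝ) (q : ℝ) : ℝ :=
  ∑' k, (2⁻¹ : ℝ) ^ (k + 1) * kinkFun (P k) q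

lemma abs_kinkFun_le {p q : ℝ} (hp : p ∈ Ioo (0 : ℝ) 1) (hq : 1 ≤ q) :
    |kinkFun p q| ≤ q * Real.log 2 := by
  rw [abs_of_nonpos (kinkFun_nonpos hp hq)]
  linarith [neg_mul_log_two_le_kinkFun hp (show 0 ≤ q by linarith)]

lemma hasSum_meanKink {P : ℕ → ℝ} (hP : ∀ k, P k ∈ Ioo (0 : ℝ) 1) {q : ℝ} (hq : 1 ≤ q) :
    HasSum (fun k => (2⁻¹ : ℝ) ^ (k + 1) * kinkFun (P k) q) (meanKink P q) := by
  refine Summable.hasSum (Summable.of_norm_bounded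
    (g := fun k => (2⁻¹ : ℝ) ^ (k + 1) * (q * Real.log 2)) ?_ fun k => ?_)
  · exact ((summable_nat_add_iff 1).2
      (summable_geometric_of_lt_one (by norm_num) (by norm_num))).mul_right _
  · rw [norm_mul, Real.norm_eq_abs, Real.norm_eq_abs, abs_of_nonneg (by positivity)]
    exact mul_le_mul_of_nonneg_left (abs_kinkFun_le (hP k) hq) (by positivity)

/-- The kink of a single term of `meanKink P` persists in the sum, the other terms being
convex. -/
lemma secondDiff_meanKink_ge {P : ℕ → ℝ} (hP : ∀ k, P k ∈ Ioo (0 : ℝ) 1) {q h : ℝ}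
    (hq : 1 ≤ q - h) (hh : 0 < h) (k : ℕ) :
    (2⁻¹ : ℝ) ^ (k + 1) *
        (kinkFun (P k) (q + h) + kinkFun (P k) (q - h) - 2 * kinkFun (P k) q)
      ≤ meanKink P (q + h) + meanKink P (q - h) - 2 * meanKink P q := by
  have hs := ((hasSum_meanKink hP (show 1 ≤ q + h by linarith)).add
    (hasSum_meanKink hP hq)).sub ((hasSum_meanKink hP (show 1 ≤ q by linarith)).mul_left 2)
  refine le_trans (le_of_eq (by ring)) (le_hasSum hs k fun i _ => ?_)
  have := mul_nonneg (show (0 : ℝ) ≤ 2⁻¹ ^ (i + 1) by positivity)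
    (secondDiff_kinkFun_nonneg (hP i) q h)
  linarith

lemma not_differentiableAt_of_secondDiff_ge {f : ℝ → ℝ} {q c : ℝ} (hc : 0 < c)
    (h : ∀ᶠ t in 𝓝[>] (0 : ℝ), c * t ≤ f (q + t) + f (q - t) - 2 * f q) :
    ¬ DifferentiableAt ℝ f q := by
  intro hf
  have h1 : HasDerivAt (fun t => f (q + t)) (deriv f q) 0 := by
    have : HasDerivAt f (deriv f q) (q + 0) := by simpa using hf.hasDerivAt
    exact this.comp_const_add q 0
  have h2 : HasDerivAt (fun t => f (q - t)) (-deriv f q) 0 := by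
    have : HasDerivAt f (deriv f q) (q - 0) := by simpa using hf.hasDerivAt
    exact this.comp_const_sub q 0
  have h3 : HasDerivAt (fun t => f (q + t) + f (q - t) - 2 * f q) 0 0 := by
    simpa using (h1.add h2).sub_const (2 * f q)
  have h4 := h3.tendsto_slope_zero_right
  refine absurd (ge_of_tendsto h4 ?_) (not_le.2 hc)
  filter_upwards [h, self_mem_nhdsWithin] with t ht ht0
  rw [mem_Ioi] at ht0
  have h0 : f (q + 0) + f (q - 0) - 2 * f q = 0 := by rw [add_zero, sub_zero]; ring
  rw [zero_add, h0, sub_zero, smul_eq_mul, inv_mul_eq_div, le_div_iff₀ ht0]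
  exact ht

/-! ### The weights -/

lemma exists_frequently_eq_finset :
    ∃ S : ℕ → Finset ℕ, ∀ F : Finset ℕ, ∃ᶠ b in atTop, S b = F := by
  obtain ⟨f, hf⟩ := exists_surjective_nat (Finset ℕ)
  refine ⟨fun b => f (Nat.unpair b).1, fun F => frequently_atTop.2 fun m => ?_⟩
  obtain ⟨a, rfl⟩ := hf F
  exact ⟨Nat.pair a m, Nat.right_le_pair a m, by simp⟩

/-- Block `b` consists of the `j` with `2 ^ 2 ^ b ≤ j < (2 ^ 2 ^ b) ^ 2`; hence each block is much
longer than all the preceding ones together. -/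
def block (j : ℕ) : ℕ := Nat.log 2 (Nat.log 2 j)

lemma block_eq {b j : ℕ} (h1 : 2 ^ 2 ^ b ≤ j) (h2 : j < (2 ^ 2 ^ b) ^ 2) : block j = b := by
  rw [← pow_mul, ← pow_succ] at h2
  have hj : j ≠ 0 := by
    have : 0 < 2 ^ 2 ^ b := by positivity
    omega
  have h3 : 2 ^ b ≤ Nat.log 2 j := Nat.le_log_of_pow_le one_lt_two h1
  have h4 : Nat.log 2 j < 2 ^ (b + 1) := Nat.log_lt_of_lt_pow hj h2
  exact Nat.log_eq_of_pow_le_of_lt_pow h3 h4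

/-- The positions `2j` and `2j+1` form the pair `j`. If the set `S b` of the block `b` of `j`
contains the dyadic class `k` of `j`, both get the weight `P k`; otherwise they get the weights
`1/2` and `(j+1)/(j+2)`. -/
noncomputable def weight (P : ℕ → ℝ) (S : ℕ → Finset ℕ) (n : ℕ) : ℝ :=
  if dyadicClass (n / 2) ∈ S (block (n / 2)) then P (dyadicClass (n / 2))
  else if Even n then 1 / 2 else ((n / 2 : ℕ) + 1) / ((n / 2 : ℕ) + 2)

lemma succ_div_mem_Ioo (j : ℕ) : ((j : ℝ) + 1) / (j + 2) ∈ Ioo (0 : ℝ) 1 :=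
  ⟨by positivity, by rw [div_lt_one (by positivity)]; linarith⟩

lemma weight_mem_Ioo {P : ℕ → ℝ} (hP : ∀ k, P k ∈ Ioo (0 : ℝ) 1) (S : ℕ → Finset ℕ) (n : ℕ) :
    weight P S n ∈ Ioo (0 : ℝ) 1 := by
  unfold weight
  split_ifs
  · exact hP _
  · norm_num
  · exact succ_div_mem_Ioo _

/-- The contribution of the pair `j` to the logarithm of the moment sum. -/
noncomputable def pairMoment (P : ℕ → ℝ) (S : ℕ → Finset ℕ) (q : ℝ) (j : ℕ) : ℝ :=
  logMoment (weight P S (2 * j)) q + logMoment (weight P S (2 * j + 1)) q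

lemma pairMoment_of_mem {P : ℕ → ℝ} {S : ℕ → Finset ℕ} {j : ℕ}
    (h : dyadicClass j ∈ S (block j)) (q : ℝ) :
    pairMoment P S q j = 2 * logMoment (P (dyadicClass j)) q := by
  have h1 : 2 * j / 2 = j := by omega
  have h2 : (2 * j + 1) / 2 = j := by omega
  simp only [pairMoment, weight, h1, h2, h, if_true]
  ring

lemma pairMoment_of_notMem {P : ℕ → ℝ} {S : ℕ → Finset ℕ} {j : ℕ}
    (h : dyadicClass j ∉ S (block j)) (q : ℝ) :
    pairMoment P S q j = (1 - q) * Real.log 2 + logMoment ((j + 1) / (j + 2)) q := by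
  have h1 : 2 * j / 2 = j := by omega
  have h2 : (2 * j + 1) / 2 = j := by omega
  have h3 : ¬ Even (2 * j + 1) := by simp
  simp only [pairMoment, weight, h1, h2, h, h3, even_two_mul, if_true, if_false, logMoment_half]

lemma pairMoment_le {P : ℕ → ℝ} {S : ℕ → Finset ℕ} {q : ℝ} (hq : 1 ≤ q) (j : ℕ) :
    pairMoment P S q j ≤ 2 * kinkFun (P (dyadicClass j)) q := by
  have h1 : logMoment (P (dyadicClass j)) q ≤ kinkFun (P (dyadicClass j)) q := le_max_left _ _
  have h2 : (1 - q) * Real.log 2 / 2 ≤ kinkFun (P (dyadicClass j)) q := le_max_right _ _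
  by_cases h : dyadicClass j ∈ S (block j)
  · rw [pairMoment_of_mem h]
    linarith
  · rw [pairMoment_of_notMem h]
    linarith [logMoment_nonpos (succ_div_mem_Ioo j) hq]

lemma neg_mul_log_two_le_pairMoment {P : ℕ → ℝ} (hP : ∀ k, P k ∈ Ioo (0 : ℝ) 1)
    (S : ℕ → Finset ℕ) {q : ℝ} (hq : 0 ≤ q) (j : ℕ) :
    -(2 * (q * Real.log 2)) ≤ pairMoment P S q j := by
  have h1 := neg_mul_log_two_le_logMoment (weight_mem_Ioo hP S (2 * j)) hq
  have h2 := neg_mul_log_two_le_logMoment (weight_mem_Ioo hP S (2 * j + 1)) hq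
  rw [pairMoment]
  linarith

lemma sum_range_two_mul (a : ℕ → ℝ) (m : ℕ) :
    ∑ i ∈ Finset.range (2 * m), a i = ∑ j ∈ Finset.range m, (a (2 * j) + a (2 * j + 1)) := by
  induction m with
  | zero => simp
  | succ m ih =>
    rw [show 2 * (m + 1) = 2 * m + 1 + 1 by ring, Finset.sum_range_succ, Finset.sum_range_succ,
      Finset.sum_range_succ, ih, add_assoc]

lemma tendsto_logMoment_succ_div {q : ℝ} (hq : 0 < q) :
    Tendsto (fun j : ℕ => logMoment ((j + 1) / (j + 2)) q) atTop (𝓝 0) := by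
  have h1 : Tendsto (fun j : ℕ => ((j : ℝ) + 1) / (j + 2)) atTop (𝓝[Ioc 0 1] 1) := by
    refine tendsto_nhdsWithin_iff.2 ⟨?_, Eventually.of_forall fun j =>
      Ioo_subset_Ioc_self (succ_div_mem_Ioo j)⟩
    have := (tendsto_add_atTop_iff_nat 1).2 (tendsto_natCast_div_add_atTop (1 : ℝ))
    refine this.congr fun j => ?_
    push_cast
    ring
  have h2 := (continuous_logMoment_left hq) 1 ⟨one_pos, le_rfl⟩
  have h3 := Tendsto.comp h2 h1
  simp only [logMoment_one hq] at h3
  exact h3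

/-! ### The spectrum -/

/-- In a block whose set `S b` is the right one for the classes below `K`, the pairs nearly reach
the upper bound of `pairMoment_le`, except in the classes from `K` on and in earlier blocks. -/
lemma le_pairMoment {P : ℕ → ℝ} (hP : ∀ k, P k ∈ Ioo (0 : ℝ) 1) {S : ℕ → Finset ℕ} {q : ℝ}
    (hq : 1 ≤ q) {K b : ℕ}
    (hS : ∀ k < K, k ∈ S b ↔ (1 - q) * Real.log 2 / 2 < logMoment (P k) q)
    {j : ℕ} (hj : j < (2 ^ 2 ^ b) ^ 2) :
    2 * kinkFun (P (dyadicClass j)) q + logMoment ((j + 1) / (j + 2)) q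
        - 2 * (q * Real.log 2) * (if K ≤ dyadicClass j then 1 else 0)
        - 2 * (q * Real.log 2) * (if j < 2 ^ 2 ^ b then 1 else 0) ≤ pairMoment P S q j := by
  have hlog := Real.log_pos one_lt_two
  have hql : 0 < q * Real.log 2 := by positivity
  have hδ := logMoment_nonpos (succ_div_mem_Ioo j) hq
  have hk := kinkFun_nonpos (hP (dyadicClass j)) hq
  have hlow := neg_mul_log_two_le_pairMoment hP S (show 0 ≤ q by linarith) j
  by_cases h1 : K ≤ dyadicClass j
  · rw [if_pos h1]
    split_ifs <;> linarith
  by_cases h2 : j < 2 ^ 2 ^ b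
  · rw [if_pos h2, if_neg h1]
    linarith
  rw [if_neg h1, if_neg h2]
  have hb := block_eq (not_lt.1 h2) hj
  have hS' := hS _ (not_le.1 h1)
  by_cases h : dyadicClass j ∈ S b
  · rw [pairMoment_of_mem (by rwa [hb]), kinkFun, max_eq_left (hS'.1 h).le]
    linarith
  · rw [pairMoment_of_notMem (by rwa [hb]), kinkFun,
      max_eq_right (not_lt.1 (mt hS'.2 h))]
    linarith

lemma sum_le_sum_pairMoment {P : ℕ → ℝ} (hP : ∀ k, P k ∈ Ioo (0 : ℝ) 1) (S : ℕ → Finset ℕ)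
    {q : ℝ} (hq : 1 ≤ q) (n : ℕ) :
    ∑ i ∈ Finset.range n, logMoment (weight P S i) q
      ≤ ∑ j ∈ Finset.range (n / 2), pairMoment P S q j := by
  have h := sum_range_two_mul (fun i => logMoment (weight P S i) q) (n / 2)
  simp only [pairMoment]
  rw [← h]
  rcases Nat.mod_two_eq_zero_or_one n with h0 | h0
  · rw [show 2 * (n / 2) = n by omega]
  · conv_lhs => rw [show n = 2 * (n / 2) + 1 by omega]
    rw [Finset.sum_range_succ]
    linarith [logMoment_nonpos (weight_mem_Ioo hP S (2 * (n / 2))) hq]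

lemma frequently_le_spectrumAt {P : ℕ → ℝ} (hP : ∀ k, P k ∈ Ioo (0 : ℝ) 1) {S : ℕ → Finset ℕ}
    (hS : ∀ F : Finset ℕ, ∃ᶠ b in atTop, S b = F) {μ : Measure (ℕ → Fin 2)}
    (hμ : ∀ n q, spectrumAt μ n q
      = 1 / (n * Real.log 2) * ∑ j ∈ Finset.range n, logMoment (weight P S j) q)
    {q : ℝ} (hq : 1 < q) {a : ℝ} (ha : a < meanKink P q / Real.log 2) :
    ∃ᶠ n in atTop, a ≤ spectrumAt μ n q := by
  have hlog := Real.log_pos one_lt_two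
  set C := q * Real.log 2
  have hC0 : 0 < C := by positivity
  rw [lt_div_iff₀ hlog] at ha
  -- the classes from `K` on, which the sets `S b` need not treat correctly, cost `C * 2⁻¹ ^ K`
  obtain ⟨K, hK⟩ : ∃ K : ℕ, C * (2⁻¹ : ℝ) ^ K < meanKink P q - a * Real.log 2 := by
    obtain ⟨K, hK⟩ := exists_pow_lt_of_lt_one (show 0 < (meanKink P q - a * Real.log 2) / C from
      div_pos (by linarith) hC0) (show (2⁻¹ : ℝ) < 1 by norm_num)
    exact ⟨K, by rwa [lt_div_iff₀' hC0] at hK⟩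
  let M (b : ℕ) : ℕ := 2 ^ 2 ^ b
  let m (b : ℕ) : ℕ := M b ^ 2
  have hMb (b : ℕ) : b ≤ M b := b.lt_two_pow_self.le.trans (2 ^ b).lt_two_pow_self.le
  have hM : Tendsto M atTop atTop := tendsto_atTop_mono hMb tendsto_id
  have hMm (b : ℕ) : M b ≤ m b := Nat.le_self_pow two_ne_zero _
  have hm : Tendsto m atTop atTop := tendsto_atTop_mono hMm hM
  have hT := ((((tendsto_average_dyadicClass (g := fun k => kinkFun (P k) q)
      fun k => abs_kinkFun_le (hP k) hq.le).comp hm).add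
    (((tendsto_logMoment_succ_div (show 0 < q by linarith)).cesaro.comp hm).const_mul
      (1 / 2))).sub (((tendsto_nat_div_div (2 ^ K)).comp hm).const_mul C)).sub
    (((tendsto_inv_atTop_zero.comp tendsto_natCast_atTop_atTop).comp hM).const_mul C)
  have hev := hT.eventually_const_le (u := a * Real.log 2) (by
    change _ < meanKink P q + _ - _ - _
    push_cast
    rw [← inv_pow]
    linarith)
  obtain ⟨F, hF⟩ : ∃ F : Finset ℕ, ∀ k < K,
      k ∈ F ↔ (1 - q) * Real.log 2 / 2 < logMoment (P k) q := by
    classical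
    refine ⟨(Finset.range K).filter fun k => (1 - q) * Real.log 2 / 2 < logMoment (P k) q,
      fun k hk => ?_⟩
    rw [Finset.mem_filter, Finset.mem_range, and_iff_right hk]
  have htwo : Tendsto (fun b => 2 * m b) atTop atTop :=
    tendsto_atTop_mono (fun b => Nat.le_mul_of_pos_left _ two_pos) hm
  refine htwo.frequently (((hS F).and_eventually hev).mono fun b hb => ?_)
  obtain ⟨rfl, hle⟩ := hb
  simp only [Function.comp_apply] at hle
  have hM0 : (0 : ℝ) < M b := by
    have : 0 < M b := by positivity
    exact_mod_cast this
  have hm0 : (0 : ℝ) < m b := by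
    have : 0 < m b := by positivity
    exact_mod_cast this
  have hmM : (m b : ℝ) = M b ^ 2 := by simp [m]
  have hcard : ((Finset.range (m b)).filter fun j => j < M b).card ≤ M b := by
    refine (Finset.card_le_card (t := Finset.range (M b)) fun j hj => ?_).trans_eq
      (Finset.card_range _)
    exact Finset.mem_range.2 (Finset.mem_filter.1 hj).2
  have hsum := Finset.sum_le_sum fun j (hj : j ∈ Finset.range (m b)) =>
    le_pairMoment hP hq.le hF (Finset.mem_range.1 hj)
  rw [Finset.sum_sub_distrib, Finset.sum_sub_distrib, Finset.sum_add_distrib, ← Finset.mul_sum,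
    ← Finset.mul_sum, ← Finset.mul_sum, Finset.sum_boole, Finset.sum_boole,
    card_le_dyadicClass] at hsum
  have hsum' := mul_le_mul_of_nonneg_left ((Nat.cast_le (α := ℝ)).2 hcard)
    (show 0 ≤ 2 * C by positivity)
  rw [hμ, sum_range_two_mul, one_div, inv_mul_eq_div, le_div_iff₀ (by positivity)]
  change _ ≤ ∑ j ∈ Finset.range (m b), pairMoment P S q j
  refine le_trans ?_ hsum
  have h2 := mul_le_mul_of_nonneg_left hle (show (0 : ℝ) ≤ 2 * m b by positivity)
  have e1 : (m b : ℝ) * (M b : ℝ)⁻¹ = M b := by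
    rw [hmM]
    field_simp
  have e2 (x : ℝ) : (m b : ℝ) * (x / m b) = x := mul_div_cancel₀ _ hm0.ne'
  have e3 (x : ℝ) : (m b : ℝ) * ((m b : ℝ)⁻¹ * x) = x := mul_inv_cancel_left₀ hm0.ne' _
  have h3 := e2 (∑ j ∈ Finset.range (m b), kinkFun (P (dyadicClass j)) q)
  have h4 := e3 (∑ j ∈ Finset.range (m b), logMoment ((j + 1) / (j + 2)) q)
  have h5 := e2 (m b / 2 ^ K : ℕ)
  push_cast
  linear_combination h2 + hsum' + 2 * h3 + h4 - 2 * C * h5 - 2 * C * e1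

/-- The spectrum on `(1, ∞)`. Every pair contributes at most twice `kinkFun` of its class, and
along the ends of those blocks that treat finitely many prescribed classes optimally this bound is
nearly attained. -/
lemma lqSpectrum_eq {P : ℕ → ℝ} (hP : ∀ k, P k ∈ Ioo (0 : ℝ) 1) {S : ℕ → Finset ℕ}
    (hS : ∀ F : Finset ℕ, ∃ᶠ b in atTop, S b = F) {μ : Measure (ℕ → Fin 2)}
    (hμ : ∀ n q, spectrumAt μ n q
      = 1 / (n * Real.log 2) * ∑ j ∈ Finset.range n, logMoment (weight P S j) q)
    {q : ℝ} (hq : 1 < q) :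
    lqSpectrum μ q = meanKink P q / Real.log 2 := by
  have hlog := Real.log_pos one_lt_two
  have hhalf : Tendsto (fun n : ℕ => n / 2) atTop atTop :=
    Nat.tendsto_div_const_atTop two_ne_zero
  have hu : Tendsto (fun n : ℕ => (2 * (((n / 2 : ℕ) : ℝ) / n)) *
      ((∑ j ∈ Finset.range (n / 2), kinkFun (P (dyadicClass j)) q) / (n / 2 : ℕ)) / Real.log 2)
      atTop (𝓝 (meanKink P q / Real.log 2)) := by
    have h := (((tendsto_nat_div_div 2).const_mul 2).mul
      ((tendsto_average_dyadicClass (g := fun k => kinkFun (P k) q)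
        fun k => abs_kinkFun_le (hP k) hq.le).comp hhalf)).div_const (Real.log 2)
    have e : 2 * ((2 : ℕ) : ℝ)⁻¹ * meanKink P q = meanKink P q := by norm_num
    rw [← e]
    exact h
  have hle (n : ℕ) : spectrumAt μ n q ≤ (2 * (((n / 2 : ℕ) : ℝ) / n)) *
      ((∑ j ∈ Finset.range (n / 2), kinkFun (P (dyadicClass j)) q) / (n / 2 : ℕ))
        / Real.log 2 := by
    have h1 := (sum_le_sum_pairMoment hP S hq.le n).trans
      (Finset.sum_le_sum fun j _ => pairMoment_le hq.le j)
    rw [← Finset.mul_sum] at h1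
    rw [hμ]
    refine (mul_le_mul_of_nonneg_left h1 (by positivity)).trans (le_of_eq ?_)
    rcases Nat.eq_zero_or_pos (n / 2) with h0 | h0
    · simp [h0]
    · have hn : (n : ℝ) ≠ 0 := by
        have : n ≠ 0 := by omega
        exact_mod_cast this
      have hn2 : ((n / 2 : ℕ) : ℝ) ≠ 0 := by exact_mod_cast h0.ne'
      field_simp
  have hfreq {a : ℝ} (ha : a < meanKink P q / Real.log 2) :=
    frequently_le_spectrumAt hP hS hμ hq ha
  have hbdd : IsBoundedUnder (· ≤ ·) atTop fun n => spectrumAt μ n q :=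
    hu.isBoundedUnder_le.mono_le (Eventually.of_forall hle)
  refine le_antisymm ?_ (le_of_forall_lt_imp_le_of_dense fun a ha =>
    le_limsup_of_frequently_le (hfreq ha) hbdd)
  rw [← hu.limsup_eq]
  exact limsup_le_limsup (Eventually.of_forall hle)
    (IsCoboundedUnder.of_frequently_ge (hfreq (sub_one_lt _))) hu.isBoundedUnder_le

end InhomBernoulli

/-- There is an inhomogeneous Bernoulli product whose phase transitions are dense
in `[1, ∞)`. -/
theorem theorem1p3 :
    ∃ μ : Measure (ℕ → Fin 2),
      InhomBernoulli.IsInhomogeneousBernoulliProduct μ ∧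
        Ici (1 : ℝ) ⊆
          closure {q : ℝ | q ∈ Ici (1 : ℝ) ∧ InhomBernoulli.IsPhaseTransition μ q} := by
  open InhomBernoulli in
  let s (k : ℕ) : ℝ := (TopologicalSpace.denseSeq (Ioi (1 : ℝ)) k : ℝ)
  have hs (k : ℕ) : 1 < s k := (TopologicalSpace.denseSeq (Ioi (1 : ℝ)) k).2
  choose P hP hPs using fun k => exists_logMoment_eq (hs k)
  have hP0 (k : ℕ) : P k ∈ Ioo (0 : ℝ) 1 := ⟨by linarith [(hP k).1], (hP k).2⟩
  obtain ⟨S, hS⟩ := exists_frequently_eq_finset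
  obtain ⟨μ, hμ⟩ := exists_measure_cyl_eq (weight P S) (weight_mem_Ioo hP0 S)
  refine ⟨μ, ⟨weight P S, weight_mem_Ioo hP0 S, hμ⟩, ?_⟩
  have hτ (q : ℝ) (hq : 1 < q) : lqSpectrum μ q = meanKink P q / Real.log 2 :=
    lqSpectrum_eq hP0 hS (spectrumAt_eq_sum (weight_mem_Ioo hP0 S) hμ) hq
  have hphase (k : ℕ) : IsPhaseTransition μ (s k) := by
    have hlog := Real.log_pos one_lt_two
    obtain ⟨c, hc, hck⟩ := exists_secondDiff_kinkFun_ge (hP k) (hs k) (hPs k)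
    refine not_differentiableAt_of_secondDiff_ge
      (c := (2⁻¹ : ℝ) ^ (k + 1) * c / Real.log 2) (by positivity) ?_
    filter_upwards [Ioo_mem_nhdsGT (show (0 : ℝ) < s k - 1 by linarith [hs k])] with t ht
    rw [hτ _ (show 1 < s k + t by linarith [hs k, ht.1]),
      hτ _ (show 1 < s k - t by linarith [ht.2]), hτ _ (hs k)]
    have h1 := secondDiff_meanKink_ge hP0 (show 1 ≤ s k - t by linarith [ht.2]) ht.1 k
    have h2 := mul_le_mul_of_nonneg_left (hck t ht.1)
      (show (0 : ℝ) ≤ 2⁻¹ ^ (k + 1) by positivity)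
    rw [← mul_div_assoc, ← add_div, ← sub_div, div_mul_eq_mul_div,
      div_le_div_iff_of_pos_right hlog]
    linarith
  have hdense : Ioi (1 : ℝ) ⊆ closure (range s) := by
    have := (TopologicalSpace.denseRange_denseSeq (Ioi (1 : ℝ)))
    intro x hx
    have h := image_closure_subset_closure_image continuous_subtype_val
      (mem_image_of_mem Subtype.val (this ⟨x, hx⟩))
    rwa [← range_comp] at h
  refine (closure_Ioi (1 : ℝ)).symm.subset.trans
    (closure_minimal (hdense.trans (closure_mono ?_)) isClosed_closure)
  rintro _ ⟨k, rfl⟩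
  exact ⟨(hs k).le, hphase k⟩
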